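/- For a positive integer $n$ write $[n]=\{1,\dots,n\}$, and let $\operatorname{Park}(n)$ be the set of parking functions of order $n$, i.e. of the functions $f:[n]\to[n]$ such that, if $A_1\le A_2\le\cdots\le A_n$ is the weakly increasing rearrangement of $f(1),\dots,f(n)$, then $A_i\le i$ for all $i\in[n]$. For $i\in[n]$ let $w_i:\operatorname{Park}(n)\to\operatorname{Park}(n)$ be whirling at index $i$: given $f\in\operatorname{Park}(n)$, add $1$ modulo $n$ (with representatives in $[n]$) to the value $f(i)$ repeatedly, at least once, until a function in $\operatorname{Park}(n)$ is obtained; this function is $w_i(f)$. Each $w_i$ is a bijection. Let $\mathbf{w}=w_n\circ\cdots\circ w_2\circ w_1$ and, for a permutation $\pi$ of $[n]$, let $\mathbf{w}_\pi=w_{\pi(n)}\circ\cdots\circ w_{\pi(2)}\circ w_{\pi(1)}$. **Theorem.** Let $n\ge 2$. 1. Every orbit of $\mathbf{w}$ on $\operatorname{Park}(n)$ has size $n+1$, and for every $i\in[n]$ every such orbit contains exactly two functions $f$ with $f(i)=1$. 2. More generally, for every permutation $\pi$ of $[n]$, every orbit of $\mathbf{w}_\pi$ on $\operatorname{Park}(n)$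 has size $n+1$, and for every $i\in[n]$ every such orbit contains exactly two functions $f$ with $f(i)=1$. -/

import Mathlib

/-!
Conventions: the set `[n] = {1, …, n}` is represented by `Fin n`, the element `j : Fin n` standing
for the integer `j + 1`. Thus the integer `1 ∈ [n]` is the `j : Fin n` with `(j : ℕ) = 0`, and
"add `1` modulo `k`" on `[k]` is the cyclic permutation `finRotate k` of `Fin k`.
-/

namespace Whirling

/-- The `i`-th entry of the weakly increasing rearrangement `f ∘ Tuple.sort f` of `f` is at most
`i`, for every `i`. (Both sides are shifted by one, so the inequality is the usual one.) -/
def IsParking {n : ℕ} (f : Fin n → Fin n) : Prop :=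
  ∀ i : Fin n, (f ∘ Tuple.sort f) i ≤ i

/-- The set of parking functions `[n] → [n]`. -/
def Park (n : ℕ) : Set (Fin n → Fin n) := {f | IsParking f}

/-- The function obtained from `f` by adding `1` (mod `k`) to the value `f i`, `m` times. -/
def bump {n k : ℕ} (f : Fin n → Fin k) (i : Fin n) (m : ℕ) : Fin n → Fin k :=
  Function.update f i ((finRotate k)^[m] (f i))

theorem exists_bump_mem {n k : ℕ} {F : Set (Fin n → Fin k)} (i : Fin n) (f : F) :
    ∃ m : ℕ, 0 < m ∧ bump f.1 i m ∈ F := by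
  refine ⟨orderOf (finRotate k), orderOf_pos _, ?_⟩
  have h : (finRotate k)^[orderOf (finRotate k)] (f.1 i) = f.1 i := by
    rw [Equiv.Perm.iterate_eq_pow, pow_orderOf_eq_one, Equiv.Perm.one_apply]
  rw [bump, h, Function.update_eq_self]
  exact f.2

open Classical in
/-- Whirling at index `i`, as a map `F → F`: add `1` (mod `k`) to the value at `i` repeatedly, at
least once, until the first time the function is in `F`. -/
noncomputable def whirlFun {n k : ℕ} (F : Set (Fin n → Fin k)) (i : Fin n) (f : F) : F :=
  ⟨bump f.1 i (Nat.find (exists_bump_mem i f)), (Nat.find_spec (exists_bump_mem i f)).2⟩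

theorem whirlFun_injective {n k : ℕ} (F : Set (Fin n → Fin k)) (i : Fin n) :
    Function.Injective (whirlFun F i) := by
  classical
  have key : ∀ (f g : F) (a b : ℕ), a ≤ b → (∀ m < b, ¬ (0 < m ∧ bump g.1 i m ∈ F)) → 0 < a →
      bump f.1 i a = bump g.1 i b → f = g := by
    intro f g a b hab hb ha h
    have hoff : ∀ j, j ≠ i → f.1 j = g.1 j := by
      intro j hj
      have := congrFun h j
      simpa [bump, hj] using this
    have hi : f.1 i = (finRotate k)^[b - a] (g.1 i) := by
      have h1 := congrFun h i
      simp only [bump, Function.update_self] at h1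
      have h2 : b = a + (b - a) := by omega
      rw [h2, Function.iterate_add_apply] at h1
      exact ((finRotate k).injective.iterate a) h1
    have hfg : f.1 = bump g.1 i (b - a) := by
      funext j
      by_cases hj : j = i
      · subst hj
        simp [bump, hi]
      · simp [bump, hj, hoff j hj]
    rcases Nat.eq_or_lt_of_le hab with e | l
    · apply Subtype.ext
      rw [hfg, e]
      simp [bump]
    · exact absurd ⟨by omega, hfg ▸ f.2⟩ (hb (b - a) (by omega))
  intro f g h
  have h' := congrArg Subtype.val h
  simp only [whirlFun] at h'
  rcases le_total (Nat.find (exists_bump_mem i f)) (Nat.find (exists_bump_mem i g)) with hl | hl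
  · exact key f g _ _ hl (fun m hm => Nat.find_min _ hm) (Nat.find_spec (exists_bump_mem i f)).1 h'
  · exact (key g f _ _ hl (fun m hm => Nat.find_min _ hm)
      (Nat.find_spec (exists_bump_mem i g)).1 h'.symm).symm

/-- Whirling at index `i`, the map `whirlFun F i`, as a permutation of the family `F`. -/
noncomputable def whirlAt {n k : ℕ} (F : Set (Fin n → Fin k)) (i : Fin n) : Equiv.Perm F :=
  Equiv.ofBijective (whirlFun F i) (Finite.injective_iff_bijective.mp (whirlFun_injective F i))

/-- Whirling in the order `π`: `w_{π(n)} ∘ ⋯ ∘ w_{π(2)} ∘ w_{π(1)}`. Products of permutations are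
composed from right to left, whence the reversal of the list. -/
noncomputable def whirlPerm {n k : ℕ} (F : Set (Fin n → Fin k)) (π : Equiv.Perm (Fin n)) :
    Equiv.Perm F :=
  ((List.finRange n).map fun j => whirlAt F (π j)).reverse.prod

/-- Left-to-right whirling: `w_n ∘ ⋯ ∘ w_2 ∘ w_1`. -/
noncomputable def whirl {n k : ℕ} (F : Set (Fin n → Fin k)) : Equiv.Perm F :=
  ((List.finRange n).map fun j => whirlAt F j).reverse.prod

/-- The set of orbits of a permutation `σ`, i.e. of the action of the cyclic group it generates. -/
def orbits {X : Type*} (σ : Equiv.Perm X) : Set (Set X) :=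
  Set.range fun x : X => MulAction.orbit (Subgroup.zpowers σ) x

end Whirling

/-! Let `c` be the long cycle `x ↦ x + 1` on `Fin (n + 1)`. The smaller elements of any
factorization of `c⁻¹` into `n` transpositions form a parking function, and every parking function
arises this way (`exists_isFactorization`), with its values read in any prescribed order of the
indices.

If `t₁ ⋯ tₙ = c⁻¹`, then `t₂ ⋯ tₙ (c t₁ c⁻¹) = c⁻¹`. On smaller elements this move is exactly
whirling at the first index (`Encodes.whirlAt`): `t₁ = (a b)` becomes `(a+1 b+1)`, with smaller
element `a + 1`, or `0` when `b = n`. A full pass of whirling therefore rotates every transposition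
by one, whatever the order of the indices.

After `k` passes the value at an index carrying `(a b)` is `min (a+k) (b+k)` modulo `n + 1`
(`Encodes.val_whirl_pow`). This has period `n + 1` and vanishes twice per period, at `k = -a` and `k
= -b`. A shorter period would make every transposition a diameter, and diameters cannot generate the
long cycle when `n ≥ 2` (`Encodes.whirl_pow_ne`). -/

namespace Whirling

/-! ### Products of transpositions and the cuts they must cross -/

section Swaps

variable {α : Type*} [DecidableEq α]

/-- The product of the transpositions given by a list of pairs. -/
def swapProd (l : List (α × α)) : Equiv.Perm α :=
  (l.map fun p => Equiv.swap p.1 p.2).prod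

@[simp] theorem swapProd_nil : swapProd ([] : List (α × α)) = 1 := rfl

@[simp] theorem swapProd_cons (p : α × α) (l : List (α × α)) :
    swapProd (p :: l) = Equiv.swap p.1 p.2 * swapProd l := by
  simp [swapProd]

@[simp] theorem swapProd_append (l₁ l₂ : List (α × α)) :
    swapProd (l₁ ++ l₂) = swapProd l₁ * swapProd l₂ := by
  simp [swapProd]

theorem swapProd_apply_mem_iff {l : List (α × α)} {U : Finset α}
    (h : ∀ p ∈ l, p.1 ∈ U ↔ p.2 ∈ U) (x : α) : swapProd l x ∈ U ↔ x ∈ U := by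
  induction l with
  | nil => simp
  | cons p l ih =>
    have h1 := h p (by simp)
    have h2 := ih fun q hq => h q (by simp [hq])
    rw [swapProd_cons, Equiv.Perm.mul_apply, ← h2, Equiv.swap_apply_def]
    split_ifs with e1 e2
    · rw [e1, h1]
    · rw [e2, h1]
    · rfl

/-- If every nonempty subset of `S` is left by an edge, then at least `S.card` edges touch `S`. -/
theorem card_le_countP_touching (l : List (α × α)) (S : Finset α)
    (h : ∀ U ⊆ S, U.Nonempty → ∃ p ∈ l, ¬ (p.1 ∈ U ↔ p.2 ∈ U)) :
    S.card ≤ l.countP (fun p => p.1 ∈ S ∨ p.2 ∈ S) := by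
  induction S using Finset.strongInduction with
  | H S ih =>
    rcases S.eq_empty_or_nonempty with rfl | hS
    · simp
    obtain ⟨p, hp, hpS⟩ := h S subset_rfl hS
    -- An edge leaving `S` has one end `v` in `S` and the other outside, so it touches `S` but not
    -- `S.erase v`.
    obtain ⟨v, hv, hvp⟩ : ∃ v ∈ S, ¬ (p.1 ∈ S.erase v ∨ p.2 ∈ S.erase v) := by
      by_cases h1 : p.1 ∈ S
      · exact ⟨p.1, h1, by simp; tauto⟩
      · exact ⟨p.2, by tauto, by simp; tauto⟩
    have h1 := ih (S.erase v) (Finset.erase_ssubset hv) fun U hU hne =>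
      h U (hU.trans (Finset.erase_subset _ _)) hne
    rw [Finset.card_erase_of_mem hv] at h1
    have hpe := List.perm_cons_erase hp
    rw [hpe.countP_eq] at h1 ⊢
    rw [List.countP_cons_of_neg (by simpa using hvp)] at h1
    rw [List.countP_cons_of_pos (by simp; tauto)]
    have h2 : (l.erase p).countP (fun p => p.1 ∈ S.erase v ∨ p.2 ∈ S.erase v) ≤
        (l.erase p).countP (fun p => p.1 ∈ S ∨ p.2 ∈ S) := by
      apply List.countP_mono_left
      intro x _ hx
      simp only [Finset.mem_erase, decide_eq_true_eq] at hx ⊢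
      tauto
    omega

end Swaps

/-! ### Hurwitz moves on smaller elements -/

section Lows

variable {α : Type*} [LinearOrder α]

/-- Two adjacent transpositions can be replaced by two others with the same product and with
exchanged smaller elements. -/
theorem exists_swap_mul_swap_eq (p q : α × α) (hp : p.1 < p.2) (hq : q.1 < q.2) :
    ∃ p' q' : α × α, p'.1 < p'.2 ∧ q'.1 < q'.2 ∧ p'.1 = q.1 ∧ q'.1 = p.1 ∧
      Equiv.swap p'.1 p'.2 * Equiv.swap q'.1 q'.2 = Equiv.swap p.1 p.2 * Equiv.swap q.1 q.2 := by
  obtain ⟨a, b⟩ := p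
  obtain ⟨c, d⟩ := q
  simp only at hp hq
  -- The two Hurwitz moves: one factor is carried past the other, which conjugates it. For distinct
  -- smaller elements, the cases choose a move that keeps the pairs ordered and exchanges those
  -- elements.
  have conj₁ : ∀ x y z w : α, Equiv.swap z w * Equiv.swap (Equiv.swap z w x) (Equiv.swap z w y) =
      Equiv.swap x y * Equiv.swap z w := by
    intro x y z w
    rw [Equiv.mul_swap_eq_swap_mul]; simp
  have conj₂ : ∀ x y z w : α, Equiv.swap (Equiv.swap x y z) (Equiv.swap x y w) * Equiv.swap x y =
      Equiv.swap x y * Equiv.swap z w := by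
    intro x y z w
    rw [← Equiv.mul_swap_eq_swap_mul]
  rcases eq_or_ne a c with rfl | hac
  · exact ⟨(a, b), (a, d), hp, hq, rfl, rfl, rfl⟩
  rcases eq_or_ne b d with rfl | hbd
  · rcases lt_or_gt_of_ne hac with h | h
    · refine ⟨(c, b), (a, c), hq, h, rfl, rfl, ?_⟩
      rw [← conj₁ a b c b, Equiv.swap_apply_of_ne_of_ne hac hp.ne, Equiv.swap_apply_right]
    · refine ⟨(c, a), (a, b), h, hp, rfl, rfl, ?_⟩
      rw [← conj₂ a b c b, Equiv.swap_apply_of_ne_of_ne hac.symm hq.ne, Equiv.swap_apply_right]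
  rcases eq_or_ne b c with rfl | hbc
  · refine ⟨(b, d), (a, d), hq, hp.trans hq, rfl, rfl, ?_⟩
    rw [← conj₁ a b b d, Equiv.swap_apply_of_ne_of_ne hac (hp.trans hq).ne, Equiv.swap_apply_left]
  rcases eq_or_ne d a with rfl | hda
  · refine ⟨(c, b), (d, b), hq.trans hp, hp, rfl, rfl, ?_⟩
    rw [← conj₂ d b c d, Equiv.swap_apply_of_ne_of_ne hac.symm hbc.symm, Equiv.swap_apply_left]
  · refine ⟨(c, d), (a, b), hq, hp, rfl, rfl, ?_⟩
    rw [← conj₁ a b c d, Equiv.swap_apply_of_ne_of_ne hac hda.symm,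
      Equiv.swap_apply_of_ne_of_ne hbc hbd]

/-- The smaller elements of a product of transpositions may be permuted arbitrarily. -/
theorem exists_swapProd_eq_of_perm {β : Type*} (v : α → β) {F G : List β} (h : F.Perm G) :
    ∀ l : List (α × α), (∀ p ∈ l, p.1 < p.2) → l.map (fun p => v p.1) = F →
      ∃ l' : List (α × α), (∀ p ∈ l', p.1 < p.2) ∧ l'.map (fun p => v p.1) = G ∧
        swapProd l' = swapProd l := by
  induction h with
  | nil => exact fun l hl e => ⟨l, hl, e, rfl⟩
  | cons x _ ih =>
    intro l hl e
    obtain ⟨p, l, rfl, rfl, e'⟩ := List.map_eq_cons_iff.1 e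
    obtain ⟨l', h1, h2, h3⟩ := ih l (fun q hq => hl q (by simp [hq])) e'
    refine ⟨p :: l', ?_, by simp [h2], by simp [h3]⟩
    simpa using ⟨hl p (by simp), fun a b hab => h1 (a, b) hab⟩
  | swap x y F =>
    intro l hl e
    obtain ⟨p, l, rfl, rfl, e₁⟩ := List.map_eq_cons_iff.1 e
    obtain ⟨q, l, rfl, rfl, e₂⟩ := List.map_eq_cons_iff.1 e₁
    obtain ⟨p', q', h1, h2, h3, h4, h5⟩ :=
      exists_swap_mul_swap_eq p q (hl p (by simp)) (hl q (by simp))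
    refine ⟨p' :: q' :: l, ?_, by simp [h3, h4, e₂], ?_⟩
    · intro r hr
      simp only [List.mem_cons] at hr
      rcases hr with rfl | rfl | hr
      · exact h1
      · exact h2
      · exact hl r (by simp [hr])
    · simp only [swapProd_cons, ← mul_assoc, h5]
  | trans _ _ ih₁ ih₂ =>
    intro l hl e
    obtain ⟨l', h1, h2, h3⟩ := ih₁ l hl e
    obtain ⟨l'', h4, h5, h6⟩ := ih₂ l' h1 h2
    exact ⟨l'', h4, h5, h6.trans h3⟩

end Lows

/-! ### Factorizations of the inverse long cycle -/

/-- `l` lists `n` transpositions of `Fin (n + 1)`, each with its smaller element first, whose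
product is the inverse of the long cycle. -/
structure IsFactorization {n : ℕ} (l : List (Fin (n + 1) × Fin (n + 1))) : Prop where
  lt : ∀ p ∈ l, p.1 < p.2
  length : l.length = n
  prod : swapProd l = (finRotate (n + 1))⁻¹

variable {n : ℕ}

theorem val_finRotate_of_lt {x : Fin (n + 1)} (h : (x : ℕ) < n) :
    (finRotate (n + 1) x : ℕ) = x + 1 := by
  rw [coe_finRotate, if_neg]
  rintro rfl
  simp at h

theorem exists_crossing_of_swapProd {l : List (Fin (n + 1) × Fin (n + 1))}
    {σ : Equiv.Perm (Fin (n + 1))} (h : swapProd l = σ⁻¹) {U : Finset (Fin (n + 1))}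
    {x : Fin (n + 1)} (hx : ¬ (σ x ∈ U ↔ x ∈ U)) : ∃ p ∈ l, ¬ (p.1 ∈ U ↔ p.2 ∈ U) := by
  by_contra! hc
  have := swapProd_apply_mem_iff hc (σ x)
  rw [h, Equiv.Perm.inv_def, Equiv.symm_apply_apply] at this
  exact hx this.symm

/-- This is the parking condition. The cycle moves the maximum of any nonempty `U ⊆ {0, …, j}` out
of `U`, so at least `j + 1` pairs touch `{0, …, j}`, and they do so with their smaller element. -/
theorem IsFactorization.lt_countP {l : List (Fin (n + 1) × Fin (n + 1))}
    (hl : IsFactorization l) {j : ℕ} (hj : j < n) :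
    j < l.countP (fun p => (p.1 : ℕ) ≤ j) := by
  have h := card_le_countP_touching l (Finset.univ.filter fun x : Fin (n + 1) => (x : ℕ) ≤ j) ?_
  · have e : (Finset.univ.filter fun x : Fin (n + 1) => (x : ℕ) ≤ j) =
        Finset.Iic (⟨j, by omega⟩ : Fin (n + 1)) := by
      ext x; simp [Fin.le_def]
    rw [e, Fin.card_Iic, ← e] at h
    refine lt_of_lt_of_le (Nat.lt_of_succ_le h) (List.countP_mono_left fun p hp => ?_)
    have := hl.lt p hp
    simp only [Finset.mem_filter, Finset.mem_univ, true_and, decide_eq_true_eq]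
    omega
  · intro U hU hne
    have hm := U.max'_mem hne
    have hlt : ((U.max' hne : Fin (n + 1)) : ℕ) ≤ j := by simpa using hU hm
    refine exists_crossing_of_swapProd hl.prod (x := U.max' hne) ?_
    have hv := val_finRotate_of_lt (x := U.max' hne) (by omega)
    intro hiff
    have := U.le_max' _ (hiff.2 hm)
    rw [Fin.le_def] at this
    omega

/-- If the first transposition moves `Fin.last n`, then few of the others start at or below its
smaller element. -/
theorem IsFactorization.countP_le {a : Fin (n + 1)} {l : List (Fin (n + 1) × Fin (n + 1))}
    (hl : IsFactorization ((a, Fin.last n) :: l)) :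
    l.countP (fun p => (p.1 : ℕ) ≤ a) ≤ a := by
  have ha : (a : ℕ) < n := by simpa [Fin.lt_def] using hl.lt (a, Fin.last n) (by simp)
  have hlen : l.length + 1 = n := by simpa using hl.length
  -- Removing the first transposition cuts the long cycle into two cycles, on `{0, …, a}` and `{a +
  -- 1, …, n}`.
  set σ := finRotate (n + 1) * Equiv.swap a (Fin.last n) with hσ
  have hprod : swapProd l = σ⁻¹ := by
    have := hl.prod
    rw [swapProd_cons] at this
    rw [hσ, mul_inv_rev, Equiv.swap_inv, ← this, Equiv.swap_mul_self_mul]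
  have σa : σ a = 0 := by simp [hσ]
  have σn : (σ (Fin.last n) : ℕ) = a + 1 := by
    rw [hσ, Equiv.Perm.mul_apply, Equiv.swap_apply_right, val_finRotate_of_lt ha]
  have σx : ∀ x : Fin (n + 1), x ≠ a → (x : ℕ) < n → (σ x : ℕ) = x + 1 := by
    intro x hxa hxn
    rw [hσ, Equiv.Perm.mul_apply, Equiv.swap_apply_of_ne_of_ne hxa, val_finRotate_of_lt hxn]
    rintro rfl
    simp at hxn
  have up : ∀ U : Finset (Fin (n + 1)), (∀ x, σ x ∈ U ↔ x ∈ U) → ∀ x ∈ U, ∀ k : ℕ,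
      ∀ y : Fin (n + 1), (y : ℕ) = x + k → ((y : ℕ) ≤ a ∨ (a : ℕ) < x) → y ∈ U := by
    intro U hU x hx k
    induction k with
    | zero => intro y hy _; rwa [Fin.ext hy]
    | succ k ih =>
      intro y hy hay
      have hz := ih ⟨x + k, by omega⟩ rfl (by simp only; omega)
      rw [← hU] at hz
      convert hz
      rw [Fin.ext_iff, σx _ (by rw [Ne, Fin.ext_iff]; simp only; omega) (by simp only; omega)]
      simp only; omega
  -- A pair joining the two blocks would leave no nonempty set avoiding `0` uncrossed, which
  -- requires `n` pairs; only `n - 1` remain.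
  have nocross : ∀ p ∈ l, (p.1 : ℕ) ≤ a → (p.2 : ℕ) ≤ a := by
    by_contra! hc
    obtain ⟨p, hp, hp1, hp2⟩ := hc
    have h := card_le_countP_touching l (Finset.univ.erase 0) ?_
    · have := h.trans List.countP_le_length
      rw [Finset.card_erase_of_mem (Finset.mem_univ _), Finset.card_univ, Fintype.card_fin] at this
      omega
    · intro U hU hne
      have h0 : (0 : Fin (n + 1)) ∉ U := fun h => by simpa using hU h
      by_cases hinv : ∀ x, σ x ∈ U ↔ x ∈ U
      · have haU : a ∉ U := fun h => h0 (by rwa [← σa, hinv])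
        have low : ∀ x : Fin (n + 1), (x : ℕ) ≤ a → x ∉ U := fun x hx h =>
          haU (up U hinv x h (a - x) a (by omega) (Or.inl le_rfl))
        obtain ⟨x, hx⟩ := hne
        have hax : (a : ℕ) < x := by
          by_contra! hle
          exact low x hle hx
        have hlast : Fin.last n ∈ U := up U hinv x hx (n - x) _ (by simp; omega) (Or.inr hax)
        have h2 : p.2 ∈ U := by
          rw [← hinv] at hlast
          exact up U hinv _ hlast (p.2 - (a + 1)) _ (by omega) (Or.inr (by omega))
        exact ⟨p, hp, by simp [h2, low _ hp1]⟩
      · push Not at hinv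
        obtain ⟨x, hx⟩ := hinv
        exact exists_crossing_of_swapProd hprod (x := x) (by tauto)
  -- The upper block uses at least `n - 1 - a` of the `n - 1` pairs, leaving at most `a` for the
  -- lower one.
  have h := card_le_countP_touching l (Finset.Ioo a (Fin.last n)) ?_
  · rw [Fin.card_Ioo, Fin.val_last] at h
    have h2 : l.countP (fun p => p.1 ∈ Finset.Ioo a (Fin.last n) ∨ p.2 ∈ Finset.Ioo a (Fin.last n))
        ≤ l.countP (fun p => ¬ (decide ((p.1 : ℕ) ≤ a) = true)) := by
      refine List.countP_mono_left fun p hp => ?_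
      have := nocross p hp
      simp only [Finset.mem_Ioo, decide_eq_true_eq, Fin.lt_def]
      omega
    have h3 := List.length_eq_countP_add_countP (fun p : Fin (n + 1) × Fin (n + 1) =>
      decide ((p.1 : ℕ) ≤ a)) (l := l)
    omega
  · intro U hU hne
    have hm := U.max'_mem hne
    have hlt := Finset.mem_Ioo.1 (hU hm)
    refine exists_crossing_of_swapProd hprod (x := U.max' hne) fun hiff => ?_
    have hv := σx _ hlt.1.ne' hlt.2
    have := U.le_max' _ (hiff.2 hm)
    rw [Fin.le_def] at this
    omega

/-! ### Rotation, and existence of a factorization for each parking function -/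

/-- Rotating both elements of a pair, and putting the smaller one first. -/
def rotatePair (p : Fin (n + 1) × Fin (n + 1)) : Fin (n + 1) × Fin (n + 1) :=
  (min (p.1 + 1) (p.2 + 1), max (p.1 + 1) (p.2 + 1))

theorem swap_min_max {α : Type*} [LinearOrder α] (x y : α) :
    Equiv.swap (min x y) (max x y) = Equiv.swap x y := by
  rcases le_total x y with h | h
  · simp [h]
  · simp [h, Equiv.swap_comm]

theorem IsFactorization.rotate {p : Fin (n + 1) × Fin (n + 1)}
    {l : List (Fin (n + 1) × Fin (n + 1))} (hl : IsFactorization (p :: l)) :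
    IsFactorization (l ++ [rotatePair p]) where
  lt := by
    intro q hq
    rcases List.mem_append.1 hq with hq | hq
    · exact hl.lt q (by simp [hq])
    · rw [List.mem_singleton] at hq
      subst hq
      have : p.2 + 1 ≠ p.1 + 1 := fun h => (hl.lt p (by simp)).ne' (add_right_cancel h)
      simpa [rotatePair] using this
  length := by simpa using hl.length
  prod := by
    have h := hl.prod
    rw [swapProd_cons] at h
    have h' : swapProd l = Equiv.swap p.1 p.2 * (finRotate (n + 1))⁻¹ := by
      rw [← h, Equiv.swap_mul_self_mul]
    rw [swapProd_append, swapProd_cons, swapProd_nil, mul_one, rotatePair, swap_min_max, h',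
      ← finRotate_apply, ← finRotate_apply, Equiv.swap_apply_apply]
    simp [mul_assoc]

theorem rotatePair_fst_of_lt {p : Fin (n + 1) × Fin (n + 1)} (h : p.1 < p.2)
    (h2 : p.2 ≠ Fin.last n) : ((rotatePair p).1 : ℕ) = p.1 + 1 := by
  have h3 : (p.2 : ℕ) < n := Fin.val_lt_last h2
  have e1 := val_finRotate_of_lt h3
  have e2 := val_finRotate_of_lt (x := p.1) (by omega)
  rw [finRotate_apply] at e1 e2
  rw [rotatePair, min_eq_left, e2]
  rw [Fin.le_def, e1, e2]
  omega

theorem rotatePair_fst_of_last {p : Fin (n + 1) × Fin (n + 1)} (h : p.2 = Fin.last n) :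
    (rotatePair p).1 = 0 := by
  simp [rotatePair, h]

/-- Base case of `exists_isFactorization`: the star at `0` has all smaller elements `0`. -/
theorem isFactorization_star :
    IsFactorization ((List.finRange n).map fun i => ((0 : Fin (n + 1)), i.succ)) where
  lt := by simp
  length := by simp
  prod := by
    have key : ∀ k (hk : k ≤ n), ∀ x : Fin (n + 1), (swapProd (((List.finRange n).take k).map
        fun i => ((0 : Fin (n + 1)), i.succ)) x : ℕ) =
        if (x : ℕ) = 0 then k else if (x : ℕ) ≤ k then x - 1 else x := by
      intro k
      induction k with
      | zero =>
        intro _ x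
        simp only [List.take_zero, List.map_nil, swapProd_nil, Equiv.Perm.one_apply]
        split_ifs <;> omega
      | succ k ih =>
        intro hk x
        rw [List.take_add_one, List.getElem?_eq_getElem (by simpa using hk), List.map_append,
          swapProd_append, Equiv.Perm.mul_apply, ih (by omega)]
        simp only [List.getElem_finRange, Option.toList_some, List.map_cons, List.map_nil,
          swapProd_cons, swapProd_nil, mul_one, Equiv.swap_apply_def, Fin.ext_iff]
        split_ifs <;> simp_all <;> omega
    have h := key n le_rfl
    rw [List.take_of_length_le (by simp)] at h
    rw [eq_inv_iff_mul_eq_one]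
    ext x
    rw [Equiv.Perm.mul_apply, h, coe_finRotate, Equiv.Perm.one_apply]
    by_cases h1 : x = Fin.last n
    · simp [h1]
    · have := Fin.val_lt_last h1
      rw [if_neg h1, if_neg (by omega), if_pos (by omega)]
      omega

/-- Every list satisfying the parking condition consists of the smaller elements of a
factorization of the long cycle. -/
theorem exists_isFactorization (F : List ℕ) (hlen : F.length = n)
    (hF : ∀ j < n, j < F.countP (fun v => v ≤ j)) :
    ∃ l : List (Fin (n + 1) × Fin (n + 1)), IsFactorization l ∧
      l.map (fun p => (p.1 : ℕ)) = F := by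
  have toPerm : ∀ {G F : List ℕ}, G.Perm F → ∀ l : List (Fin (n + 1) × Fin (n + 1)),
      IsFactorization l → l.map (fun p => (p.1 : ℕ)) = G →
      ∃ l : List (Fin (n + 1) × Fin (n + 1)), IsFactorization l ∧
        l.map (fun p => (p.1 : ℕ)) = F := by
    intro G F hGF l hl hG
    obtain ⟨l', h1, h2, h3⟩ := exists_swapProd_eq_of_perm _ hGF l hl.lt hG
    refine ⟨l', ⟨h1, ?_, h3.trans hl.prod⟩, h2⟩
    have e := congrArg List.length h2
    rw [List.length_map, ← hGF.length_eq, ← hG, List.length_map] at e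
    exact e.trans hl.length
  induction hs : F.sum using Nat.strong_induction_on generalizing F with
  | _ s ih =>
    by_cases h0 : ∀ v ∈ F, v = 0
    · refine ⟨_, isFactorization_star, ?_⟩
      rw [List.eq_replicate_of_mem h0, hlen]
      simp [Function.comp_def]
    · push Not at h0
      obtain ⟨v, hv, hv0⟩ := h0
      obtain ⟨v, rfl⟩ := Nat.exists_eq_succ_of_ne_zero hv0
      have hperm := List.perm_cons_erase hv
      set G := F.erase (v + 1) with hG
      have hsum : s = v + 1 + G.sum := by rw [← hs, hperm.sum_eq, List.sum_cons]
      have hlenG : G.length + 1 = n := by rw [← hlen, hperm.length_eq, List.length_cons]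
      simp only [hperm.countP_eq] at hF
      -- Lowering one positive entry preserves the parking condition. With the lowered entry `v` in
      -- front, rotating the first pair raises it back to `v + 1`, unless that pair ends at
      -- `Fin.last n`.
      obtain ⟨l, hl, hlG⟩ := ih (v + G.sum) (by omega) (v :: G) (by simpa using hlenG)
        (fun j hj => by
          have := hF j hj
          simp only [List.countP_cons, decide_eq_true_eq] at this ⊢
          split_ifs at this ⊢ <;> omega) (by simp)
      obtain ⟨p, l, rfl, hpv, hlG⟩ := List.map_eq_cons_iff.1 hlG
      have hlt := hl.lt p (by simp)
      have hp2 : p.2 ≠ Fin.last n := by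
        intro hlast
        -- A pair ending at `Fin.last n` would leave at most `v` other entries `≤ v`, whereas the
        -- parking condition for the original list requires `v + 1` of them.
        have h1 : l.countP (fun p => (p.1 : ℕ) ≤ v) ≤ v := by
          obtain ⟨a, b⟩ := p
          simp only at hlast hpv
          subst hlast hpv
          exact hl.countP_le
        have h2 := hF v (by omega)
        rw [List.countP_cons_of_neg (by simp), ← hlG, List.countP_map] at h2
        simp only [Function.comp_def] at h2
        omega
      refine toPerm ?_ _ hl.rotate rfl
      rw [List.map_append, hlG, List.map_singleton, rotatePair_fst_of_lt hlt hp2, hpv]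
      exact (List.perm_append_singleton _ _).trans hperm.symm

theorem isParking_iff_lt_countP {s : List (Fin n)} (hs : s.Perm (List.finRange n))
    (g : Fin n → Fin n) :
    IsParking g ↔ ∀ j < n, j < (s.map fun i => (g i : ℕ)).countP (fun v => v ≤ j) := by
  have key : ∀ i : Fin n, (g ∘ Tuple.sort g) i ≤ i ↔
      (i : ℕ) < (s.map fun i => (g i : ℕ)).countP (fun v => v ≤ (i : ℕ)) := by
    intro i
    rw [← Tuple.lt_card_le_iff_apply_le_of_monotone (Tuple.monotone_sort g)]
    have h1 : (Finset.univ.filter fun k => (g ∘ Tuple.sort g) k ≤ i).card =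
        (Finset.univ.filter fun k => g k ≤ i).card :=
      Finset.card_equiv (Tuple.sort g) (by simp)
    have h2 : (Finset.univ.filter fun k => g k ≤ i).card =
        (s.map fun i => (g i : ℕ)).countP (fun v => v ≤ (i : ℕ)) := by
      rw [(hs.map _).countP_eq, List.countP_map, List.countP_eq_length_filter, Finset.card_def,
        Finset.filter_val, Finset.val_univ_fin, Multiset.filter_coe, Multiset.coe_card]
      rfl
    rw [h1, h2]
  exact ⟨fun h j hj => (key ⟨j, hj⟩).1 (h ⟨j, hj⟩), fun h i => (key i).2 (h i i.2)⟩

/-! ### Whirling as rotation of a transposition -/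

theorem val_finRotate_iterate {k : ℕ} (m : ℕ) (x : Fin k) :
    ((finRotate k)^[m] x : ℕ) = (x + m) % k := by
  have := x.neZero
  induction m with
  | zero => simp [Nat.mod_eq_of_lt x.2]
  | succ m ih =>
    rw [Function.iterate_succ_apply', finRotate_apply, Fin.val_add, ih, Fin.val_one',
      ← Nat.add_mod, add_assoc]

theorem whirlAt_eq_update {k : ℕ} {F : Set (Fin n → Fin k)} {i : Fin n} {f : F} {v : Fin k} {m : ℕ}
    (hm : 0 < m) (hv : (f.1 i + m) % k = v) (hF : Function.update f.1 i v ∈ F)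
    (hmin : ∀ m', 0 < m' → m' < m → ∀ u : Fin k, (u : ℕ) = (f.1 i + m') % k →
      Function.update f.1 i u ∉ F) :
    (whirlAt F i f).1 = Function.update f.1 i v := by
  classical
  have hbm : bump f.1 i m = Function.update f.1 i v := by
    rw [bump]
    congr 1
    rw [Fin.ext_iff, val_finRotate_iterate, hv]
  have hfind : Nat.find (exists_bump_mem i f) = m := by
    rw [Nat.find_eq_iff]
    refine ⟨⟨hm, hbm ▸ hF⟩, fun m' hm' h => ?_⟩
    exact hmin m' h.1 hm' _ (val_finRotate_iterate _ _) h.2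
  rw [← hbm, ← hfind]
  simp only [whirlAt, Equiv.ofBijective_apply, whirlFun]

theorem whirlAt_eq_update_succ {k : ℕ} {F : Set (Fin n → Fin k)} {i : Fin n} {f : F} {v : Fin k}
    (hv : (v : ℕ) = f.1 i + 1) (hF : Function.update f.1 i v ∈ F) :
    (whirlAt F i f).1 = Function.update f.1 i v :=
  whirlAt_eq_update one_pos (by rw [← hv, Nat.mod_eq_of_lt v.2]) hF (by omega)

theorem whirlAt_eq_update_zero {k : ℕ} {F : Set (Fin n → Fin k)} {i : Fin n} {f : F} {v : Fin k}
    (hv : (v : ℕ) = 0) (hF : Function.update f.1 i v ∈ F)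
    (hmax : ∀ u : Fin k, f.1 i < u → Function.update f.1 i u ∉ F) :
    (whirlAt F i f).1 = Function.update f.1 i v := by
  have := (f.1 i).2
  refine whirlAt_eq_update (m := k - f.1 i) (by omega) ?_ hF fun m' h1 h2 u hu => hmax u ?_
  · rw [show (f.1 i : ℕ) + (k - f.1 i) = k by omega, Nat.mod_self, hv]
  · rw [Nat.mod_eq_of_lt (by omega)] at hu
    rw [Fin.lt_def]; omega

/-- The values of `f`, read in the order `s`, are the smaller elements of the factorization `l`. -/
structure Encodes (s : List (Fin n)) (l : List (Fin (n + 1) × Fin (n + 1))) (f : Fin n → Fin n) :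
    Prop where
  fact : IsFactorization l
  perm : s.Perm (List.finRange n)
  map_eq : l.map (fun p => (p.1 : ℕ)) = s.map fun i => (f i : ℕ)

theorem exists_encodes {s : List (Fin n)} (hs : s.Perm (List.finRange n)) (f : Park n) :
    ∃ l, Encodes s l f.1 := by
  obtain ⟨l, hl, h⟩ := exists_isFactorization (s.map fun i => (f.1 i : ℕ))
    (by simpa using hs.length_eq) ((isParking_iff_lt_countP hs f.1).1 f.2)
  exact ⟨l, hl, hs, h⟩

theorem Encodes.isParking {s : List (Fin n)} {l : List (Fin (n + 1) × Fin (n + 1))}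
    {f : Fin n → Fin n} (h : Encodes s l f) : IsParking f := by
  rw [isParking_iff_lt_countP h.perm, ← h.map_eq]
  intro j hj
  rw [List.countP_map]
  exact h.fact.lt_countP hj

theorem Encodes.rotate_update {i : Fin n} {s : List (Fin n)} {p : Fin (n + 1) × Fin (n + 1)}
    {l : List (Fin (n + 1) × Fin (n + 1))} {f : Fin n → Fin n} (h : Encodes (i :: s) (p :: l) f)
    {v : Fin n} (hv : (v : ℕ) = (rotatePair p).1) :
    Encodes (s ++ [i]) (l ++ [rotatePair p]) (Function.update f i v) where
  fact := h.fact.rotate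
  perm := (List.perm_append_singleton _ _).trans h.perm
  map_eq := by
    have hi : i ∉ s := (List.nodup_cons.1 (h.perm.nodup_iff.2 (List.nodup_finRange n))).1
    have h1 := h.map_eq
    rw [List.map_cons, List.map_cons, List.cons.injEq] at h1
    rw [List.map_append, List.map_append, h1.2]
    congr 1
    · refine List.map_congr_left fun j hj => ?_
      rw [Function.update_of_ne]
      rintro rfl
      exact hi hj
    · simp [hv]

/-- Whirling at the first index rotates the first transposition. -/
theorem Encodes.whirlAt {i : Fin n} {s : List (Fin n)} {p : Fin (n + 1) × Fin (n + 1)}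
    {l : List (Fin (n + 1) × Fin (n + 1))} {f : Park n} (h : Encodes (i :: s) (p :: l) f.1) :
    Encodes (s ++ [i]) (l ++ [rotatePair p]) (whirlAt (Park n) i f).1 := by
  have hlt := h.fact.lt p (by simp)
  have h1 := h.map_eq
  rw [List.map_cons, List.map_cons, List.cons.injEq] at h1
  by_cases hp : p.2 = Fin.last n
  · have h0 := rotatePair_fst_of_last hp
    have hE := h.rotate_update (v := ⟨0, i.pos⟩) (by simp [h0])
    rwa [whirlAt_eq_update_zero (v := ⟨0, i.pos⟩) rfl hE.isParking]
    -- The other indices have at most `p.1` values `≤ p.1`, so any larger value at `i` breaks the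
    -- parking condition at `p.1`, and whirling must wrap around to `0`.
    intro u hu hpark
    have hi : i ∉ s := (List.nodup_cons.1 (h.perm.nodup_iff.2 (List.nodup_finRange n))).1
    have hc : l.countP (fun q => (q.1 : ℕ) ≤ p.1) ≤ p.1 := by
      obtain ⟨a, b⟩ := p
      simp only at hp
      subst hp
      exact h.fact.countP_le
    have h2 := (isParking_iff_lt_countP h.perm _).1 hpark p.1 (by omega)
    rw [List.map_cons, Function.update_self, List.countP_cons_of_neg (by
      simp only [decide_eq_true_eq]; omega)] at h2
    have e : (s.map fun j => (Function.update f.1 i u j : ℕ)) = s.map fun j => (f.1 j : ℕ) := by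
      refine List.map_congr_left fun j hj => ?_
      rw [Function.update_of_ne]
      rintro rfl
      exact hi hj
    rw [e, ← h1.2, List.countP_map] at h2
    simp only [Function.comp_def] at h2
    omega
  · have h0 := rotatePair_fst_of_lt hlt hp
    have h2 := Fin.val_lt_last hp
    have hE := h.rotate_update (v := ⟨p.1 + 1, by omega⟩) (by simp [h0])
    rwa [whirlAt_eq_update_succ (by simp [h1.1]) hE.isParking]

/-- Each whirl moves the head of both lists to the end, so the next index to whirl is again in
front; `s₂` and `l₂` collect what follows during the induction. -/
theorem Encodes.prod_whirlAt {s₁ : List (Fin n)} : ∀ {s₂ : List (Fin n)}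
    {l₁ l₂ : List (Fin (n + 1) × Fin (n + 1))} {f : Park n}, s₁.length = l₁.length →
    Encodes (s₁ ++ s₂) (l₁ ++ l₂) f.1 →
    Encodes (s₂ ++ s₁) (l₂ ++ l₁.map rotatePair)
      ((s₁.map fun i => Whirling.whirlAt (Park n) i).reverse.prod f).1 := by
  induction s₁ with
  | nil =>
    intro s₂ l₁ l₂ f hlen h
    obtain rfl := List.length_eq_zero_iff.1 hlen.symm
    simpa using h
  | cons i s₁ ih =>
    intro s₂ l₁ l₂ f hlen h
    obtain ⟨p, l₁, rfl⟩ := List.exists_cons_of_length_eq_add_one hlen.symm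
    have h1 : Encodes (s₁ ++ (s₂ ++ [i])) (l₁ ++ (l₂ ++ [rotatePair p]))
        (Whirling.whirlAt (Park n) i f).1 := by
      rw [← List.append_assoc, ← List.append_assoc]
      exact h.whirlAt
    have h2 := ih (by simpa using hlen) h1
    simpa [List.append_assoc, List.prod_append] using h2

theorem Encodes.whirl {s : List (Fin n)} {l : List (Fin (n + 1) × Fin (n + 1))} {f : Park n}
    (h : Encodes s l f.1) : Encodes s (l.map rotatePair)
      ((s.map fun i => Whirling.whirlAt (Park n) i).reverse.prod f).1 := by
  have hlen : s.length = l.length := by simpa using (congrArg List.length h.map_eq).symm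
  simpa using Encodes.prod_whirlAt (s₂ := []) (l₂ := []) hlen (by simpa using h)

/-! ### Iterated passes and the exact period -/

theorem rotatePair_iterate {p : Fin (n + 1) × Fin (n + 1)} (h : p.1 < p.2) (k : ℕ) :
    rotatePair^[k] p = (min ((finRotate (n + 1))^[k] p.1) ((finRotate (n + 1))^[k] p.2),
      max ((finRotate (n + 1))^[k] p.1) ((finRotate (n + 1))^[k] p.2)) := by
  induction k with
  | zero => simp [h.le]
  | succ k ih =>
    simp only [Function.iterate_succ_apply', ih, finRotate_apply]
    generalize (finRotate (n + 1))^[k] p.1 = x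
    generalize (finRotate (n + 1))^[k] p.2 = y
    rcases le_total x y with hxy | hxy
    · simp [rotatePair, hxy]
    · simp [rotatePair, hxy, min_comm, max_comm]

theorem Encodes.whirl_pow {s : List (Fin n)} {l : List (Fin (n + 1) × Fin (n + 1))} {f : Park n}
    (h : Encodes s l f.1) (k : ℕ) : Encodes s (l.map rotatePair^[k])
      (((s.map fun i => Whirling.whirlAt (Park n) i).reverse.prod ^ k) f).1 := by
  induction k with
  | zero => simpa using h
  | succ k ih =>
    have := ih.whirl
    rwa [List.map_map, ← Function.iterate_succ', ← Equiv.Perm.mul_apply, ← pow_succ'] at this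

theorem Encodes.val_whirl_pow {s : List (Fin n)} {l : List (Fin (n + 1) × Fin (n + 1))}
    {f : Park n} (h : Encodes s l f.1) (k : ℕ) {m : ℕ} (hm : m < s.length) (hm' : m < l.length) :
    ((((s.map fun i => Whirling.whirlAt (Park n) i).reverse.prod ^ k) f).1 s[m] : ℕ) =
      min ((l[m].1 + k) % (n + 1)) ((l[m].2 + k) % (n + 1)) := by
  have h1 := (h.whirl_pow k).map_eq
  have h2 : (((l.map rotatePair^[k]).map fun p => (p.1 : ℕ))[m]'(by simpa using hm')) =
      ((s.map fun i => ((((s.map fun i => Whirling.whirlAt (Park n) i).reverse.prod ^ k) f).1 i :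
        ℕ))[m]'(by simpa using hm)) := by
    simp only [h1]
  rw [List.getElem_map, List.getElem_map, List.getElem_map,
    rotatePair_iterate (h.fact.lt _ (List.getElem_mem hm'))] at h2
  rw [← h2, Fin.coe_min, val_finRotate_iterate, val_finRotate_iterate]

theorem add_mod_eq_zero_iff {a k N : ℕ} (h : a + k < 2 * N) :
    (a + k) % N = 0 ↔ a + k = 0 ∨ a + k = N := by
  rw [← Nat.dvd_iff_mod_eq_zero]
  constructor
  · rintro ⟨c, hc⟩
    have hc2 : c < 2 := by
      by_contra! h2
      have := Nat.mul_le_mul_left N h2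
      omega
    interval_cases c <;> omega
  · rintro (h | h) <;> simp [h]

theorem Encodes.whirl_pow_ne (hn : 2 ≤ n) {s : List (Fin n)}
    {l : List (Fin (n + 1) × Fin (n + 1))} {f : Park n} (h : Encodes s l f.1) {k : ℕ} (hk : 0 < k)
    (hk' : k < n + 1) : ((s.map fun i => Whirling.whirlAt (Park n) i).reverse.prod ^ k) f ≠ f := by
  intro hfix
  have hlen : s.length = l.length := by simpa using (congrArg List.length h.map_eq).symm
  -- A shift by `k` permutes the two zero times `-a` and `-b` of each pair; as `0 < k < n + 1`, it
  -- exchanges them.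
  have key : ∀ p ∈ l, (p.2 : ℕ) = p.1 + k ∧ 2 * k = n + 1 := by
    intro p hp
    have hlt := h.fact.lt p hp
    obtain ⟨m, hm, rfl⟩ := List.getElem_of_mem hp
    have hz : ∀ t, min ((l[m].1 + (t + k)) % (n + 1)) ((l[m].2 + (t + k)) % (n + 1)) =
        min ((l[m].1 + t) % (n + 1)) ((l[m].2 + t) % (n + 1)) := by
      intro t
      rw [← h.val_whirl_pow (t + k) (hlen ▸ hm) hm, ← h.val_whirl_pow t (hlen ▸ hm) hm, pow_add,
        Equiv.Perm.mul_apply, hfix]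
    generalize l[m] = p at *
    obtain ⟨a, b⟩ := p
    simp only [Fin.lt_def] at hlt hz ⊢
    have ha := hz (n + 1 - a)
    have hb := hz (n + 1 - b)
    have r1 : (a + (n + 1 - a)) % (n + 1) = 0 := by
      rw [show (a : ℕ) + (n + 1 - a) = n + 1 by omega, Nat.mod_self]
    have r2 : (b + (n + 1 - b)) % (n + 1) = 0 := by
      rw [show (b : ℕ) + (n + 1 - b) = n + 1 by omega, Nat.mod_self]
    have r3 : (a + (n + 1 - a + k)) % (n + 1) = k := by
      rw [show (a : ℕ) + (n + 1 - a + k) = n + 1 + k by omega, Nat.add_mod_left,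
        Nat.mod_eq_of_lt hk']
    have r4 : (b + (n + 1 - b + k)) % (n + 1) = k := by
      rw [show (b : ℕ) + (n + 1 - b + k) = n + 1 + k by omega, Nat.add_mod_left,
        Nat.mod_eq_of_lt hk']
    have r5 : (b + (n + 1 - a + k)) % (n + 1) = (b - a + k) % (n + 1) := by
      rw [show (b : ℕ) + (n + 1 - a + k) = n + 1 + (b - a + k) by omega, Nat.add_mod_left]
    have s5 := add_mod_eq_zero_iff (a := b - a) (k := k) (N := n + 1) (by omega)
    have s6 := add_mod_eq_zero_iff (a := a) (k := n + 1 - b + k) (N := n + 1) (by omega)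
    rw [r1, r3, r5] at ha
    rw [r2, r4] at hb
    omega
  have hn' := h.fact.length
  obtain ⟨p₀, hp₀⟩ : ∃ p, p ∈ l := List.exists_mem_of_length_pos (by omega)
  have h2k := (key p₀ hp₀).2
  obtain ⟨x, hx⟩ : ∃ x : Fin (n + 1), (x : ℕ) = k := ⟨⟨k, hk'⟩, rfl⟩
  -- When all pairs are diameters, none crosses `{0, k}`; yet the cycle sends `k` to `k + 1`,
  -- outside this set.
  obtain ⟨p, hp, hcross⟩ := exists_crossing_of_swapProd h.fact.prod (U := {0, x}) (x := x) (by
      have := val_finRotate_of_lt (x := x) (by omega)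
      simp only [Finset.mem_insert, Finset.mem_singleton, Fin.ext_iff, this, Fin.val_zero, or_true,
        iff_true]
      omega)
  have := (key p hp).1
  apply hcross
  simp only [Finset.mem_insert, Finset.mem_singleton, Fin.ext_iff, Fin.val_zero]
  omega

theorem Encodes.whirl_pow_eq {s : List (Fin n)} {l : List (Fin (n + 1) × Fin (n + 1))} {f : Park n}
    (h : Encodes s l f.1) :
    ((s.map fun i => Whirling.whirlAt (Park n) i).reverse.prod ^ (n + 1)) f = f := by
  have hlen : s.length = l.length := by simpa using (congrArg List.length h.map_eq).symm
  apply Subtype.ext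
  funext i
  obtain ⟨m, hm, rfl⟩ := List.getElem_of_mem (h.perm.mem_iff.2 (List.mem_finRange i))
  have h1 := h.val_whirl_pow (n + 1) hm (hlen ▸ hm)
  have h2 := h.val_whirl_pow 0 hm (hlen ▸ hm)
  rw [Nat.add_mod_right, Nat.add_mod_right] at h1
  rw [pow_zero, add_zero, add_zero] at h2
  exact Fin.ext (h1.trans h2.symm)

/-! ### Counting in an orbit -/

theorem orbit_zpowers_eq_image {X : Type*} {σ : Equiv.Perm X} {x : X} {N : ℕ} (hN : 0 < N)
    (h : (σ ^ N) x = x) :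
    MulAction.orbit (Subgroup.zpowers σ) x =
      (fun k : ℕ => (σ ^ k) x) '' (Finset.range N : Set ℕ) := by
  ext y
  constructor
  · rintro ⟨⟨_, z, rfl⟩, rfl⟩
    have hz := Int.emod_add_mul_ediv z N
    have h0 : 0 ≤ z % (N : ℤ) := Int.emod_nonneg _ (by omega)
    have h1 : z % (N : ℤ) < N := Int.emod_lt_of_pos _ (by omega)
    have hfix : ((σ ^ N) ^ (z / N)) x = x := Function.IsFixedPt.perm_zpow h _
    refine ⟨(z % N).toNat, by simp; omega, ?_⟩
    have e : σ ^ z = σ ^ (z % (N : ℤ)).toNat * (σ ^ N) ^ (z / N) := by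
      rw [← zpow_natCast, ← zpow_natCast, ← zpow_mul, ← zpow_add, Int.toNat_of_nonneg h0, hz]
    change _ = (σ ^ z) x
    rw [e, Equiv.Perm.mul_apply, hfix]
  · rintro ⟨k, -, rfl⟩
    exact ⟨⟨σ ^ k, k, by simp⟩, rfl⟩

theorem orbit_card_and_count (hn : 2 ≤ n) {s : List (Fin n)} (hs : s.Perm (List.finRange n))
    (f : Park n) :
    (MulAction.orbit (Subgroup.zpowers
      (s.map fun i => whirlAt (Park n) i).reverse.prod) f).ncard = n + 1 ∧
    ∀ i : Fin n, {g ∈ MulAction.orbit (Subgroup.zpowers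
      (s.map fun i => whirlAt (Park n) i).reverse.prod) f | (g.1 i : ℕ) = 0}.ncard = 2 := by
  obtain ⟨l, h⟩ := exists_encodes hs f
  have hlen : s.length = l.length := by simpa using (congrArg List.length h.map_eq).symm
  have hpow := h.whirl_pow_eq
  have hne : ∀ {k}, 0 < k → k < n + 1 → _ := fun hk hk' => h.whirl_pow_ne hn hk hk'
  have hval := fun k m hm hm' => h.val_whirl_pow k (m := m) hm hm'
  generalize (s.map fun i => whirlAt (Park n) i).reverse.prod = σ at *
  have hinj : Set.InjOn (fun k : ℕ => (σ ^ k) f) (Finset.range (n + 1) : Set ℕ) := by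
    have aux : ∀ i j : ℕ, i ≤ j → j < n + 1 → (σ ^ i) f = (σ ^ j) f → i = j := by
      intro i j hij hj e
      by_contra hne'
      refine hne (k := j - i) (by omega) (by omega) ?_
      rw [show j = i + (j - i) by omega, pow_add, Equiv.Perm.mul_apply] at e
      exact ((σ ^ i).injective e).symm
    intro i hi j hj e
    simp only [Finset.coe_range, Set.mem_Iio] at hi hj
    rcases le_total i j with hij | hij
    · exact aux i j hij hj e
    · exact (aux j i hij hi e.symm).symm
  rw [orbit_zpowers_eq_image (Nat.succ_pos n) hpow]
  refine ⟨by rw [hinj.ncard_image, Set.ncard_coe_finset, Finset.card_range], fun i => ?_⟩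
  obtain ⟨m, hm, rfl⟩ := List.getElem_of_mem (h.perm.mem_iff.2 (List.mem_finRange i))
  have hm' : m < l.length := hlen ▸ hm
  have hlt := h.fact.lt _ (List.getElem_mem hm')
  have hv := fun k => hval k m hm hm'
  generalize l[m] = p at *
  obtain ⟨a, b⟩ := p
  simp only [Fin.lt_def] at hlt hv
  -- The zero times are `-b` and `-a` modulo `n + 1`, with representatives in `range (n + 1)`; hence
  -- the separate value `0` when `a = 0`, while `b > a` is never `0`.
  have hset : {g ∈ (fun k : ℕ => (σ ^ k) f) '' (Finset.range (n + 1) : Set ℕ) |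
      (g.1 s[m] : ℕ) = 0} = (fun k : ℕ => (σ ^ k) f) ''
        ((Finset.range (n + 1)).filter fun k => k = n + 1 - b ∨ k = if (a : ℕ) = 0 then 0 else
          n + 1 - a : Finset ℕ) := by
    have hk : ∀ k < n + 1, (((σ ^ k) f).1 s[m] : ℕ) = 0 ↔
        (k = n + 1 - b ∨ k = if (a : ℕ) = 0 then 0 else n + 1 - a) := by
      intro k hk
      have s1 := add_mod_eq_zero_iff (a := a) (k := k) (N := n + 1) (by omega)
      have s2 := add_mod_eq_zero_iff (a := b) (k := k) (N := n + 1) (by omega)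
      rw [hv]
      split_ifs <;> omega
    ext g
    constructor
    · rintro ⟨⟨k, hkr, rfl⟩, hg⟩
      have hkn : k < n + 1 := by simpa using hkr
      refine ⟨k, ?_, rfl⟩
      rw [Finset.coe_filter]
      exact ⟨hkr, (hk k hkn).1 hg⟩
    · rintro ⟨k, hkr, rfl⟩
      rw [Finset.coe_filter] at hkr
      exact ⟨⟨k, hkr.1, rfl⟩, (hk k (by simpa using hkr.1)).2 hkr.2⟩
  rw [hset, (hinj.mono (Finset.coe_subset.2 (Finset.filter_subset _ _))).ncard_image,
    Set.ncard_coe_finset]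
  have hpair : ((Finset.range (n + 1)).filter fun k => k = n + 1 - b ∨ k = if (a : ℕ) = 0 then 0
      else n + 1 - a) = {n + 1 - (b : ℕ), if (a : ℕ) = 0 then 0 else n + 1 - a} := by
    ext k
    simp only [Finset.mem_filter, Finset.mem_range, Finset.mem_insert, Finset.mem_singleton]
    split_ifs <;> omega
  rw [hpair, Finset.card_pair]
  split_ifs <;> omega

end Whirling

/-- Every orbit of whirling on `Park n` has size `n + 1` and, for each index `i`, contains exactly
two parking functions whose value at `i` is the least element of `[n]` (the integer `1`, which is
`0` in `Fin n`); the same holds for whirling in any order `π`. -/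
theorem mainTheorem2 (n : ℕ) (hn : 2 ≤ n) :
    (∀ O ∈ Whirling.orbits (Whirling.whirl (Whirling.Park n)),
      O.ncard = n + 1 ∧
      ∀ i : Fin n, {f ∈ O | ((f : Fin n → Fin n) i : ℕ) = 0}.ncard = 2) ∧
    (∀ π : Equiv.Perm (Fin n),
      ∀ O ∈ Whirling.orbits (Whirling.whirlPerm (Whirling.Park n) π),
        O.ncard = n + 1 ∧
        ∀ i : Fin n, {f ∈ O | ((f : Fin n → Fin n) i : ℕ) = 0}.ncard = 2) := by
  constructor
  · rintro _ ⟨f, rfl⟩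
    exact Whirling.orbit_card_and_count hn (List.Perm.refl _) f
  · rintro π _ ⟨f, rfl⟩
    have h := Whirling.orbit_card_and_count hn π.map_finRange_perm f
    rw [List.map_map] at h
    exact h
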